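/- For $N\ge 1$ let $\mathbb S_N\subset(\mathbb C^2)^{\otimes N}$ be the symmetric subspace (the vectors invariant under all permutations of the $N$ spins), and for $0\le n\le N$ let $|n\rangle\in\mathbb S_N$ be the normalized Dicke state with $n$ spins up, i.e. $\binom Nn^{-1/2}$ times the sum of all computational basis kets with exactly $n$ spins up; set $|n\rangle=0$ for integers $n$ outside $\{0,\dots,N\}$. For real $s>0$ the comb state $|C(s)\rangle$ with spacing $s$ is the unit vector obtained by normalizing $$\sum_{m\in\mathbb Z,\ |m|\le N/s}\big|\lfloor N/2+ms\rfloor\big\rangle .$$ For a unit vector $|\Psi\rangle\in(\mathbb C^2)^{\otimes N}$ and a set $A$ of spins with complement $B$, let $E(|\Psi\rangle,\{A,B\})=-\mathrm{Tr}(\rho_A\log_2\rho_A)$, where $\rho_A=\mathrm{Tr}_B|\Psi\rangle\langle\Psi|$, be the entropy of entanglement. **Theorem.** There are constants $\delta>0$ and $N^*>0$ such that, for every integer $N>N^*$, there is a unit vector $|\Psi\rangle\in\mathbb S_N$ with $$\log_2\!\big(\lfloor N/2\rfloor+1\big)-E\big(|\Psi\rangle,\{A,B\}\big)<\delta$$ for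 every partition $\{A,B\}$ of the $N$ spins with $|A|=\lfloor N/2\rfloor$ and $|B|=\lceil N/2\rceil$. More precisely, one can take for $|\Psi\rangle$ the comb state $|C(\sqrt{2N})\rangle$; indeed, with the same $\delta$ and $N^*$, every comb state $|C(s)\rangle$ with $s$ real and $|s-\sqrt{2N}|\le 1$ (so also with $\sqrt{2N}$ rounded down or up to an integer) is a unit vector in $\mathbb S_N$ that satisfies the inequality. -/

import Mathlib

open scoped BigOperators

noncomputable section

/-- Vectors of the Hilbert space `(ℂ²)^{⊗N}` of `N` spins-1/2, written in the computational basis: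
`x : Fin N → Fin 2` stands for the product ket `|x₁ ⋯ x_N⟩`, and `x i = 1` says that spin `i` is
up. -/
abbrev SpinVector (N : ℕ) : Type := EuclideanSpace ℂ (Fin N → Fin 2)

/-- The symmetric subspace `𝕊_N`: the vectors fixed by all permutations of the `N` spins. -/
def symmetricSubspace (N : ℕ) : Submodule ℂ (SpinVector N) where
  carrier := {ψ | ∀ (π : Equiv.Perm (Fin N)) (x : Fin N → Fin 2), ψ (x ∘ π) = ψ x}
  add_mem' := by
    intro φ ψ hφ hψ π x
    simp [hφ π x, hψ π x]
  zero_mem' := by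
    intro π x
    simp
  smul_mem' := by
    intro c ψ hψ π x
    simp [hψ π x]

/-- The number of spins up in a basis configuration. -/
def excitations {N : ℕ} (x : Fin N → Fin 2) : ℕ :=
  (Finset.univ.filter fun i => x i = 1).card

/-- The normalized Dicke state `|n⟩` of `N` spins: the sum of all basis kets with exactly `n`
spins up, divided by the square root of their number `N.choose n`. There is no basis ket with
`n < 0` or `n > N` spins up, so that `|n⟩ = 0` for these `n`. -/
def dickeState (N : ℕ) (n : ℤ) : SpinVector N :=
  WithLp.toLp 2 fun x =>
    if (excitations x : ℤ) = n then (((√(N.choose (excitations x) : ℝ))⁻¹ : ℝ) : ℂ) else 0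

/-- The unnormalized comb vector `∑_{-N/s ≤ m ≤ N/s} |N/2 + m s⟩` with spacing `s`, where a
non-integer label is rounded down, and labels outside `0, …, N` contribute nothing. -/
def combVector (N : ℕ) (s : ℝ) : SpinVector N :=
  ∑ m ∈ Finset.Icc (-⌊(N : ℝ) / s⌋) ⌊(N : ℝ) / s⌋, dickeState N ⌊(N : ℝ) / 2 + m * s⌋

/-- The comb state `|C(s)⟩` of `N` spins, i.e. the comb vector normalized to length one. -/
def combState (N : ℕ) (s : ℝ) : SpinVector N :=
  ((‖combVector N s‖⁻¹ : ℝ) : ℂ) • combVector N s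

/-- The basis configuration of all spins that is `a` on the spins in `A` and `b` on the others. -/
def glue {N : ℕ} (A : Finset (Fin N)) (a : {i // i ∈ A} → Fin 2) (b : {i // i ∉ A} → Fin 2) :
    Fin N → Fin 2 :=
  (Equiv.piEquivPiSubtypeProd (fun i => i ∈ A) fun _ => Fin 2).symm (a, b)

/-- The reduced density matrix `ρ_A = Tr_B |ψ⟩⟨ψ|`, where `B` is the complement of `A`. -/
def reducedDensity {N : ℕ} (ψ : SpinVector N) (A : Finset (Fin N)) :
    Matrix ({i // i ∈ A} → Fin 2) ({i // i ∈ A} → Fin 2) ℂ :=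
  Matrix.of fun a a' => ∑ b : {i // i ∉ A} → Fin 2, ψ (glue A a b) * star (ψ (glue A a' b))

theorem reducedDensity_isHermitian {N : ℕ} (ψ : SpinVector N) (A : Finset (Fin N)) :
    (reducedDensity ψ A).IsHermitian := by
  ext a a'
  simp [reducedDensity, Matrix.conjTranspose_apply, mul_comm]

/-- The von Neumann entropy `S(ρ) = -Tr (ρ log₂ ρ)`, computed from the eigenvalues of `ρ` with
multiplicity, with the usual convention `0 log₂ 0 = 0`. -/
def vonNeumannEntropy {ι : Type*} [Fintype ι] [DecidableEq ι] (ρ : Matrix ι ι ℂ)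
    (hρ : ρ.IsHermitian) : ℝ :=
  -∑ i, hρ.eigenvalues i * Real.logb 2 (hρ.eigenvalues i)

/-- The entropy of entanglement `E(ψ, {A, B}) = S(ρ_A)` of a pure state `ψ` with respect to the
partition of the spins into `A` and its complement `B`. -/
def entanglementEntropy {N : ℕ} (ψ : SpinVector N) (A : Finset (Fin N)) : ℝ :=
  vonNeumannEntropy (reducedDensity ψ A) (reducedDensity_isHermitian ψ A)

end

/-! The von Neumann entropy is at least minus the logarithm of the purity
(`neg_logb_le_vonNeumannEntropy`), so it suffices that the reduced state of a half has purity
`O(1/N)`. The squared norm of the comb vector is its number of teeth, which is at least of order `N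
/ s`, that is `√N`. Hence it is enough to bound the purity of the unnormalized vector by a constant
(`sum_sq_gram_combAmplitude_le`).

In the Dicke bases of the two halves the comb vector is a matrix `ψ a b` supported where `a + b` is
a tooth. On the antidiagonal `a + b = n` the squares `ψ a b ^ 2` form a hypergeometric distribution:
its height is of order at most `1/√(n+1) + 1/√(N-n+1)`, and it decays once `|a - b|` exceeds `√N`
(`hypergeometric_mul_pow_le`). Since the spacing is at least `√(N+1)`, a row has boundedly many
sizeable entries and overlaps appreciably with boundedly many other rows. `sum_sq_gram_le` makes
this precise with Lorentzian weights, whose sums along a progression are bounded by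
`sum_lorentzian_le`.

What remains is the sum of `ψ ^ 4 * f ^ 3`, with `f` the inverse Lorentzian. One factor `ψ ^ 2` sums
to one over each tooth by Vandermonde; the other, together with `f ^ 3`, is bounded by the height,
and the heights sum to `O(1)` over all teeth (`sum_combTeeth_le`). -/

/-! ### Size and decay of binomial coefficients -/

theorem sq_centralBinom_mul_le (m : ℕ) : m.centralBinom ^ 2 * (2 * m + 1) ≤ 16 ^ m := by
  induction m with
  | zero => simp
  | succ m ih =>
    have h := Nat.succ_mul_centralBinom_succ m
    refine Nat.le_of_mul_le_mul_left (c := (m + 1) ^ 2) ?_ (by positivity)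
    calc (m + 1) ^ 2 * ((m + 1).centralBinom ^ 2 * (2 * (m + 1) + 1))
        = ((m + 1) * (m + 1).centralBinom) ^ 2 * (2 * m + 3) := by ring
      _ = m.centralBinom ^ 2 * (2 * m + 1) * (4 * ((2 * m + 1) * (2 * m + 3))) := by rw [h]; ring
      _ ≤ 16 ^ m * (4 * (4 * (m + 1) ^ 2)) := by
        gcongr ?_ * (4 * ?_)
        nlinarith
      _ = (m + 1) ^ 2 * 16 ^ (m + 1) := by ring

theorem le_sq_centralBinom_mul (m : ℕ) : 16 ^ m ≤ m.centralBinom ^ 2 * (4 * m + 1) := by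
  induction m with
  | zero => simp
  | succ m ih =>
    have h := Nat.succ_mul_centralBinom_succ m
    refine Nat.le_of_mul_le_mul_left (c := (m + 1) ^ 2 * (4 * m + 1)) ?_ (by positivity)
    calc (m + 1) ^ 2 * (4 * m + 1) * 16 ^ (m + 1)
        = 16 ^ m * (16 * ((m + 1) ^ 2 * (4 * m + 1))) := by ring
      _ ≤ m.centralBinom ^ 2 * (4 * m + 1) * (4 * ((2 * m + 1) ^ 2 * (4 * m + 5))) := by
        gcongr ?_ * ?_
        nlinarith
      _ = (2 * (2 * m + 1) * m.centralBinom) ^ 2 * (4 * m + 5) * (4 * m + 1) := by ring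
      _ = (m + 1) ^ 2 * (4 * m + 1) * ((m + 1).centralBinom ^ 2 * (4 * (m + 1) + 1)) := by
        rw [← h]; ring

/-- Reduces the middle of an odd row to the centre of the next even row. -/
theorem centralBinom_succ_eq_two_mul_choose (m : ℕ) :
    (m + 1).centralBinom = 2 * (2 * m + 1).choose m := by
  have h : (2 * m + 1).choose (m + 1) = (2 * m + 1).choose m :=
    Nat.choose_symm_of_eq_add (by ring)
  rw [Nat.centralBinom, show 2 * (m + 1) = (2 * m + 1) + 1 by ring, Nat.choose_succ_succ, h]
  ring

theorem sq_choose_half_mul_le (n : ℕ) : n.choose (n / 2) ^ 2 * (n + 1) ≤ (2 ^ n) ^ 2 := by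
  obtain ⟨m, rfl | rfl⟩ := Nat.even_or_odd' n
  · have := sq_centralBinom_mul_le m
    rw [Nat.mul_div_cancel_left _ two_pos]
    calc _ ≤ 16 ^ m := this
      _ = _ := by rw [← pow_mul, show 2 * m * 2 = 4 * m by ring, pow_mul]; norm_num
  · have := sq_centralBinom_mul_le (m + 1)
    rw [centralBinom_succ_eq_two_mul_choose] at this
    rw [show (2 * m + 1) / 2 = m by omega]
    have h2 : (2 ^ (2 * m + 1)) ^ 2 * 4 = 16 ^ (m + 1) := by
      rw [← pow_mul, show (2 * m + 1) * 2 = 4 * m + 2 by ring, pow_add, pow_mul]; norm_num; ring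
    nlinarith [sq_nonneg ((2 * m + 1).choose m)]

theorem le_sq_choose_half_mul (n : ℕ) : (2 ^ n) ^ 2 ≤ n.choose (n / 2) ^ 2 * (3 * (n + 1)) := by
  obtain ⟨m, rfl | rfl⟩ := Nat.even_or_odd' n
  · have := le_sq_centralBinom_mul m
    rw [Nat.mul_div_cancel_left _ two_pos]
    calc _ = 16 ^ m := by rw [← pow_mul, show 2 * m * 2 = 4 * m by ring, pow_mul]; norm_num
      _ ≤ _ := this
      _ ≤ _ := by rw [Nat.centralBinom]; refine Nat.mul_le_mul_left _ ?_; omega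
  · have := le_sq_centralBinom_mul (m + 1)
    rw [centralBinom_succ_eq_two_mul_choose] at this
    rw [show (2 * m + 1) / 2 = m by omega]
    have h2 : (2 ^ (2 * m + 1)) ^ 2 * 4 = 16 ^ (m + 1) := by
      rw [← pow_mul, show (2 * m + 1) * 2 = 4 * m + 2 by ring, pow_add, pow_mul]; norm_num; ring
    nlinarith [sq_nonneg ((2 * m + 1).choose m)]

theorem choose_half_mul_sqrt_le (n : ℕ) : (n.choose (n / 2) : ℝ) * √(n + 1) ≤ 2 ^ n := by
  refine abs_le_of_sq_le_sq' ?_ (by positivity) |>.2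
  rw [mul_pow, Real.sq_sqrt (by positivity)]
  exact_mod_cast sq_choose_half_mul_le n

theorem two_pow_le_choose_half_mul_sqrt (n : ℕ) :
    (2 : ℝ) ^ n ≤ 2 * (n.choose (n / 2) * √(n + 1)) := by
  refine abs_le_of_sq_le_sq' ?_ (by positivity) |>.2
  rw [mul_pow, mul_pow, Real.sq_sqrt (by positivity)]
  have : ((2 : ℝ) ^ n) ^ 2 ≤ n.choose (n / 2) ^ 2 * (3 * (n + 1)) := by
    exact_mod_cast le_sq_choose_half_mul n
  have h : (0 : ℝ) ≤ (n.choose (n / 2) : ℝ) ^ 2 * (n + 1) := by positivity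
  linarith

/-- The exponent grows by exactly `(2a - n + 1)/(n + 1)`, while the ratio of consecutive
coefficients is `1 - (2a - n + 1)/(a + 1)`. So `1 - x ≤ exp (-x)` suffices right of the centre, and
a Gaussian of this width is absorbed. -/
theorem choose_succ_mul_exp_le {n a : ℕ} (ha : n ≤ 2 * a + 1) :
    (n.choose (a + 1) : ℝ) * Real.exp ((2 * (a + 1 : ℕ) - n : ℝ) ^ 2 / (4 * (n + 1))) ≤
      n.choose a * Real.exp ((2 * a - n : ℝ) ^ 2 / (4 * (n + 1))) := by
  rcases le_or_gt n a with h | h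
  · rw [Nat.choose_eq_zero_of_lt (show n < a + 1 by omega)]
    simp only [Nat.cast_zero, zero_mul]
    positivity
  have ha' : (n : ℝ) ≤ 2 * a + 1 := by exact_mod_cast ha
  have hn : (a : ℝ) + 1 ≤ n := by exact_mod_cast h
  have hr : (n.choose (a + 1) : ℝ) * (a + 1) = n.choose a * (n - a) := by
    have := Nat.choose_succ_right_eq n a
    rw [← Nat.cast_sub h.le]
    exact_mod_cast this
  have hratio : ((n : ℝ) - a) / (a + 1) ≤ Real.exp (-((2 * a - n + 1) / (n + 1))) := by
    calc ((n : ℝ) - a) / (a + 1) = -((2 * a - n + 1) / (a + 1)) + 1 := by field_simp; ring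
      _ ≤ Real.exp (-((2 * a - n + 1) / (a + 1))) := Real.add_one_le_exp _
      _ ≤ _ := by
        gcongr
        linarith
  have he : (2 * (a + 1 : ℕ) - n : ℝ) ^ 2 / (4 * (n + 1)) =
      (2 * a - n : ℝ) ^ 2 / (4 * (n + 1)) + (2 * a - n + 1) / (n + 1) := by
    push_cast
    field_simp
    ring
  have hc : (n.choose (a + 1) : ℝ) = n.choose a * ((n - a) / (a + 1)) := by
    field_simp
    linarith
  rw [he, hc, Real.exp_add]
  calc _ = n.choose a * Real.exp ((2 * a - n : ℝ) ^ 2 / (4 * (n + 1))) *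
        (((n : ℝ) - a) / (a + 1) * Real.exp ((2 * a - n + 1) / (n + 1))) := by ring
    _ ≤ n.choose a * Real.exp ((2 * a - n : ℝ) ^ 2 / (4 * (n + 1))) *
        (Real.exp (-((2 * a - n + 1) / (n + 1))) * Real.exp ((2 * a - n + 1) / (n + 1))) := by
      gcongr
    _ = _ := by rw [← Real.exp_add]; simp

theorem choose_mul_exp_le_of_half_le {n a : ℕ} (ha : n / 2 ≤ a) :
    (n.choose a : ℝ) * Real.exp ((2 * a - n : ℝ) ^ 2 / (4 * (n + 1))) ≤
      2 * n.choose (n / 2) := by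
  induction a, ha using Nat.le_induction with
  | base =>
    have h1 : (2 * (n / 2 : ℕ) - n : ℝ) ^ 2 ≤ 1 := by
      have h2 : ((2 * (n / 2 : ℕ) : ℕ) : ℝ) ≤ n := by exact_mod_cast Nat.mul_div_le n 2
      have h3 : (n : ℝ) ≤ ((2 * (n / 2 : ℕ) + 1 : ℕ) : ℝ) := by exact_mod_cast (by omega)
      push_cast at h2 h3
      rw [sq_le_one_iff_abs_le_one, abs_le]
      constructor <;> linarith
    have h4 : Real.exp ((2 * (n / 2 : ℕ) - n : ℝ) ^ 2 / (4 * (n + 1))) ≤ 2 := by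
      calc _ ≤ Real.exp (1 / 2) := by
            rw [Real.exp_le_exp, div_le_iff₀ (by positivity)]
            have : (0 : ℝ) ≤ n := by positivity
            linarith
        _ ≤ 2 := by
          have := Real.exp_bound_div_one_sub_of_interval (x := 1 / 2) (by norm_num) (by norm_num)
          norm_num at this ⊢
          exact this
    rw [mul_comm]
    gcongr
  | succ a ha ih => exact (choose_succ_mul_exp_le (by omega)).trans ih

theorem choose_mul_exp_le (n a : ℕ) :
    (n.choose a : ℝ) * Real.exp ((2 * a - n : ℝ) ^ 2 / (4 * (n + 1))) ≤
      2 * n.choose (n / 2) := by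
  rcases le_or_gt (n / 2) a with h | h
  · exact choose_mul_exp_le_of_half_le h
  · have han : a ≤ n := by omega
    have := choose_mul_exp_le_of_half_le (n := n) (a := n - a) (by omega)
    rw [Nat.choose_symm han, Nat.cast_sub han] at this
    convert this using 4
    ring

/-- Trades the Gaussian for the cubic decay used later; the rate `t / 4` matches the exponent in
`choose_mul_exp_le`. -/
theorem one_add_pow_three_le_exp {t : ℝ} (ht : 0 ≤ t) :
    (1 + t) ^ 3 ≤ 12 ^ 3 * Real.exp (t / 4) := by
  have h : 1 + t ≤ 12 * Real.exp (t / 12) := by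
    have := Real.add_one_le_exp (t / 12)
    linarith
  calc (1 + t) ^ 3 ≤ (12 * Real.exp (t / 12)) ^ 3 := by gcongr
    _ = 12 ^ 3 * Real.exp (t / 4) := by
      rw [mul_pow, ← Real.exp_nat_mul]
      congr 2
      push_cast
      ring

/-- A binomial coefficient is at most `2 ^ n / √n`, with rapid decay away from the centre. -/
theorem choose_mul_pow_mul_sqrt_le (n a : ℕ) :
    (n.choose a : ℝ) * (1 + (2 * a - n : ℝ) ^ 2 / (n + 1)) ^ 3 * √(n + 1) ≤
      2 * 12 ^ 3 * 2 ^ n := by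
  have h1 := one_add_pow_three_le_exp (t := (2 * a - n : ℝ) ^ 2 / (n + 1)) (by positivity)
  have h2 := choose_mul_exp_le n a
  rw [div_div, mul_comm ((n : ℝ) + 1) 4] at h1
  calc _ ≤ (n.choose a : ℝ) *
        (12 ^ 3 * Real.exp ((2 * a - n : ℝ) ^ 2 / (4 * (n + 1)))) * √(n + 1) := by gcongr
    _ = 12 ^ 3 * (n.choose a * Real.exp ((2 * a - n : ℝ) ^ 2 / (4 * (n + 1)))) * √(n + 1) := by
      ring
    _ ≤ 12 ^ 3 * (2 * n.choose (n / 2)) * √(n + 1) := by gcongr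
    _ = 2 * 12 ^ 3 * (n.choose (n / 2) * √(n + 1)) := by ring
    _ ≤ _ := by gcongr; exact choose_half_mul_sqrt_le n

theorem choose_mul_sqrt_le (n a : ℕ) : (n.choose a : ℝ) * √(n + 1) ≤ 2 ^ n := by
  refine le_trans ?_ (choose_half_mul_sqrt_le n)
  gcongr
  exact_mod_cast Nat.choose_le_middle a n

/-! ### The hypergeometric distribution -/

/-- Both sides count pairs of a `k`-subset and an `(a + b)`-subset of a `(k + l)`-set that meet in
`a` elements. -/
theorem choose_mul_choose_mul_choose {k l a b : ℕ} (ha : a ≤ k) (hb : b ≤ l) :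
    (k.choose a : ℝ) * l.choose b * (k + l).choose k =
      (k + l).choose (a + b) * ((a + b).choose a * (k + l - (a + b)).choose (k - a)) := by
  obtain ⟨c, rfl⟩ := Nat.exists_eq_add_of_le ha
  obtain ⟨d, rfl⟩ := Nat.exists_eq_add_of_le hb
  rw [show a + c + (b + d) - (a + b) = c + d by omega, show a + c - a = c by omega,
    Nat.cast_add_choose, Nat.cast_add_choose, Nat.cast_add_choose, Nat.cast_add_choose,
    Nat.cast_add_choose, show a + c + (b + d) = (a + b) + (c + d) by ring, Nat.cast_add_choose]
  field_simp

/-- Pointwise bound with rapid decay for the hypergeometric distribution that arises when a Dicke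
state is cut into halves. -/
theorem hypergeometric_mul_pow_le {N a b : ℕ} (ha : a ≤ N / 2) (hb : b ≤ N - N / 2) :
    ((N / 2).choose a * (N - N / 2).choose b / N.choose (a + b) : ℝ) *
        (1 + (a - b : ℝ) ^ 2 / (N + 1)) ^ 3 ≤
      4 * 12 ^ 3 * (1 / √((a + b : ℕ) + 1) + 1 / √((N - (a + b) : ℕ) + 1)) := by
  set n := a + b with hn
  have hnN : n ≤ N := by omega
  have hid := choose_mul_choose_mul_choose ha hb
  rw [show N / 2 + (N - N / 2) = N by omega, ← hn] at hid
  have h1 := choose_mul_pow_mul_sqrt_le n a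
  have h2 := choose_mul_sqrt_le (N - n) (N / 2 - a)
  have h3 := two_pow_le_choose_half_mul_sqrt N
  have hC : (0 : ℝ) < N.choose n := by exact_mod_cast Nat.choose_pos hnN
  have hH : (0 : ℝ) < N.choose (N / 2) := by exact_mod_cast Nat.choose_pos (Nat.div_le_self N 2)
  have hnN' : (n : ℝ) ≤ N := by exact_mod_cast hnN
  have hd : (1 + (a - b : ℝ) ^ 2 / (N + 1)) ≤ 1 + (2 * a - n : ℝ) ^ 2 / (n + 1) := by
    rw [show (2 * a - n : ℝ) = a - b by rw [hn]; push_cast; ring]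
    gcongr
  have hs : √((N : ℝ) + 1) ≤ √((n : ℝ) + 1) + √((N - n : ℕ) + 1) := by
    refine Real.sqrt_le_iff.2 ⟨by positivity, ?_⟩
    rw [add_sq, Real.sq_sqrt (by positivity), Real.sq_sqrt (by positivity), Nat.cast_sub hnN]
    have : 0 ≤ √((n : ℝ) + 1) * √((N : ℝ) - n + 1) := by positivity
    linarith
  -- After this exchange the denominator is a central coefficient, bounded below. All the decay
  -- comes from `n.choose a`, whose displacement `2a - n` equals `a - b`; the other factor needs
  -- only its maximum.
  have hq : ((N / 2).choose a * (N - N / 2).choose b / N.choose n : ℝ) =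
      n.choose a * (N - n).choose (N / 2 - a) / N.choose (N / 2) := by
    rw [div_eq_div_iff hC.ne' hH.ne', hid]
    ring
  rw [hq]
  set x := √((n : ℝ) + 1)
  set y := √(((N - n : ℕ) : ℝ) + 1)
  have hx : 0 < x := by positivity
  have hy : 0 < y := by positivity
  have hp : (2 : ℝ) ^ n * 2 ^ (N - n) = 2 ^ N := by rw [← pow_add]; congr 1; omega
  rw [show 1 / x + 1 / y = (x + y) / (x * y) by field_simp; ring, div_mul_eq_mul_div,
    ← mul_div_assoc, div_le_div_iff₀ hH (by positivity)]
  calc _ = (n.choose a * (1 + (a - b : ℝ) ^ 2 / (N + 1)) ^ 3 * x) *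
        ((N - n).choose (N / 2 - a) * y) := by ring
    _ ≤ (n.choose a * (1 + (2 * a - n : ℝ) ^ 2 / (n + 1)) ^ 3 * x) *
        ((N - n).choose (N / 2 - a) * y) := by gcongr
    _ ≤ 2 * 12 ^ 3 * 2 ^ n * 2 ^ (N - n) := by gcongr
    _ = 2 * 12 ^ 3 * 2 ^ N := by rw [← hp]; ring
    _ ≤ 2 * 12 ^ 3 * (2 * (N.choose (N / 2) * √(N + 1))) := by gcongr
    _ ≤ 2 * 12 ^ 3 * (2 * (N.choose (N / 2) * (x + y))) := by gcongr
    _ = _ := by ring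

/-! ### Lorentzian sums near an arithmetic progression -/

theorem summable_one_div_one_add_int_sq : Summable fun i : ℤ => 1 / (1 + (i : ℝ) ^ 2) := by
  have h := (Real.summable_one_div_int_pow (p := 2)).2 (by norm_num)
  refine Summable.of_nonneg_of_le (fun i => by positivity) (fun i => ?_)
    (h.add (hasSum_ite_eq (0 : ℤ) (1 : ℝ)).summable)
  rcases eq_or_ne i 0 with rfl | hi
  · simp
  · have hi' : (0 : ℝ) < (i : ℝ) ^ 2 := by positivity
    simp only [hi, if_false, add_zero]
    gcongr
    linarith

/-- A constant that bounds the sum of a Lorentzian over any set of naturals close to an arithmetic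
progression whose step exceeds the width of the Lorentzian. -/
noncomputable def lorentzianBound : ℝ := 64 * ∑' i : ℤ, 1 / (1 + (i : ℝ) ^ 2)

theorem lorentzianBound_pos : 0 < lorentzianBound :=
  mul_pos (by norm_num) <| summable_one_div_one_add_int_sq.tsum_pos (fun i => by positivity) 0
    (by norm_num)

theorem card_filter_abs_sub_lt_one_le (Y : Finset ℕ) (x : ℝ) :
    (Y.filter fun y : ℕ => |(y : ℝ) - x| < 1).card ≤ 2 := by
  refine (Finset.card_le_card_of_injOn (t := ({⌊x⌋, ⌊x⌋ + 1} : Finset ℤ))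
    (fun y : ℕ => (y : ℤ)) ?_ (Nat.cast_injective.injOn)).trans Finset.card_le_two
  intro y hy
  simp only [Finset.coe_filter, Set.mem_ofPred_eq, abs_lt] at hy
  have h1 := Int.floor_le x
  have h2 := Int.lt_floor_add_one x
  have h3 : ((y : ℤ) : ℝ) < ((⌊x⌋ + 2 : ℤ) : ℝ) := by push_cast; linarith
  have h4 : ((⌊x⌋ - 1 : ℤ) : ℝ) < ((y : ℤ) : ℝ) := by push_cast; linarith
  have h3' := Int.cast_lt.1 h3
  have h4' := Int.cast_lt.1 h4
  simp only [Finset.coe_insert, Finset.coe_singleton, Set.mem_insert_iff, Set.mem_singleton_iff]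
  omega

/-- The progression is reindexed so that index zero lies nearest the peak `e`. Then index `J` forces
`|y - e|` to be at least `|J| * s / 4`, and the width `√L` is at most of order `s`, so the sum is
dominated by that of `1/(1 + J²)`. At most two naturals share an index. -/
theorem sum_lorentzian_le {s L : ℝ} (hs : 4 ≤ s) (hL : 0 < L) (hLs : L ≤ 2 * s ^ 2) (c e : ℝ)
    (Y : Finset ℕ) (hY : ∀ y ∈ Y, ∃ j : ℤ, |(y : ℝ) - (c + j * s)| < 1) :
    ∑ y ∈ Y, 1 / (1 + ((y : ℝ) - e) ^ 2 / L) ≤ lorentzianBound := by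
  classical
  choose! j hj using hY
  have hs0 : 0 < s := by linarith
  set i₀ := round ((c - e) / s) with hi₀
  have hround : |c - e - i₀ * s| ≤ s / 2 := by
    have h := abs_sub_round ((c - e) / s)
    rw [← hi₀] at h
    calc |c - e - i₀ * s| = |(c - e) / s - i₀| * s := by
          rw [← abs_of_pos hs0, ← abs_mul, abs_of_pos hs0]; congr 1; field_simp
      _ ≤ 1 / 2 * s := by gcongr
      _ = s / 2 := by ring
  have hterm : ∀ y ∈ Y, 1 / (1 + ((y : ℝ) - e) ^ 2 / L) ≤
      32 * (1 / (1 + ((j y + i₀ : ℤ) : ℝ) ^ 2)) := by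
    intro y hy
    set J : ℤ := j y + i₀ with hJ
    have hd : |(y : ℝ) - e - J * s| ≤ s / 2 + 1 := by
      calc |(y : ℝ) - e - J * s| = |((y : ℝ) - (c + j y * s)) + (c - e - i₀ * s)| := by
            rw [hJ]; push_cast; congr 1; ring
        _ ≤ _ := (abs_add_le _ _).trans (by linarith [hj y hy])
    have hsq : (J : ℝ) ^ 2 * L ≤ 32 * ((y : ℝ) - e) ^ 2 := by
      rcases eq_or_ne J 0 with h0 | h0
      · rw [h0]; simp; positivity
      · have h1 : (1 : ℝ) ≤ |(J : ℝ)| := by exact_mod_cast Int.one_le_abs h0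
        have h2 : |(J : ℝ)| * s ≤ |(y : ℝ) - e| + (s / 2 + 1) := by
          calc |(J : ℝ)| * s = |(J : ℝ) * s| := by rw [abs_mul, abs_of_pos hs0]
            _ = |((y : ℝ) - e) - ((y : ℝ) - e - J * s)| := by congr 1; ring
            _ ≤ |(y : ℝ) - e| + |(y : ℝ) - e - J * s| := abs_sub _ _
            _ ≤ _ := by linarith
        -- Here `s / 2 + 1 ≤ 3 * s / 4` because `4 ≤ s`, and `|J| ≥ 1`.
        have h3 : |(J : ℝ)| * s / 4 ≤ |(y : ℝ) - e| := by nlinarith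
        have h4 : (|(J : ℝ)| * s / 4) ^ 2 ≤ |(y : ℝ) - e| ^ 2 := by gcongr
        rw [sq_abs, div_pow, mul_pow, sq_abs] at h4
        calc (J : ℝ) ^ 2 * L ≤ (J : ℝ) ^ 2 * (2 * s ^ 2) := by gcongr
          _ ≤ _ := by linarith
    rw [mul_one_div, div_le_div_iff₀ (by positivity) (by positivity)]
    have : (J : ℝ) ^ 2 ≤ 32 * (((y : ℝ) - e) ^ 2 / L) := by
      rw [← mul_div_assoc, le_div_iff₀ hL]; exact hsq
    linarith
  have hfib : ∀ i : ℤ, (Y.filter fun y => j y + i₀ = i).card ≤ 2 := by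
    intro i
    refine (Finset.card_le_card ?_).trans
      (card_filter_abs_sub_lt_one_le Y (c + (i - i₀ : ℤ) * s))
    intro y hy
    rw [Finset.mem_filter] at hy ⊢
    refine ⟨hy.1, ?_⟩
    rw [← hy.2, add_sub_cancel_right]
    exact hj y hy.1
  calc _ ≤ ∑ y ∈ Y, 32 * (1 / (1 + ((j y + i₀ : ℤ) : ℝ) ^ 2)) := Finset.sum_le_sum hterm
    _ = ∑ i ∈ Y.image (fun y => j y + i₀), (Y.filter fun y => j y + i₀ = i).card •
        (32 * (1 / (1 + (i : ℝ) ^ 2))) :=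
      Finset.sum_comp (fun i : ℤ => 32 * (1 / (1 + (i : ℝ) ^ 2))) (fun y => j y + i₀)
    _ ≤ ∑ i ∈ Y.image (fun y => j y + i₀), 64 * (1 / (1 + (i : ℝ) ^ 2)) := by
      refine Finset.sum_le_sum fun i _ => ?_
      rw [nsmul_eq_mul]
      have h : ((Y.filter fun y => j y + i₀ = i).card : ℝ) ≤ 2 := by exact_mod_cast hfib i
      calc _ ≤ 2 * (32 * (1 / (1 + (i : ℝ) ^ 2))) := by gcongr
        _ = _ := by ring
    _ = 64 * ∑ i ∈ Y.image (fun y => j y + i₀), 1 / (1 + (i : ℝ) ^ 2) := by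
      rw [Finset.mul_sum]
    _ ≤ _ := by
      unfold lorentzianBound
      gcongr
      exact summable_one_div_one_add_int_sq.sum_le_tsum _ fun i _ => by positivity

/-! ### Inverse square roots along an arithmetic progression -/

theorem sum_one_div_sqrt_le (n : ℕ) : ∑ j ∈ Finset.range (n + 1), 1 / √(j : ℝ) ≤ 2 * √(n : ℝ) := by
  induction n with
  | zero => simp
  | succ n ih =>
    rw [Finset.sum_range_succ]
    have h1 : 0 < √((n + 1 : ℕ) : ℝ) := by positivity
    have h2 : √((n + 1 : ℕ) : ℝ) ^ 2 = n + 1 := by rw [Real.sq_sqrt (by positivity)]; simp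
    have h3 : √(n : ℝ) ^ 2 = n := Real.sq_sqrt (by positivity)
    have h4 : 1 / √((n + 1 : ℕ) : ℝ) ≤ 2 * (√((n + 1 : ℕ) : ℝ) - √(n : ℝ)) := by
      rw [div_le_iff₀ h1]
      nlinarith [sq_nonneg (√((n + 1 : ℕ) : ℝ) - √(n : ℝ))]
    linarith

/-- In units of `s` the points have distinct integer parts `i ≤ L / s ≤ s`. The part `i = 0`
contributes at most 1, and the others at most `(1/√s) * ∑ 1/√i ≤ 2`. -/
theorem sum_one_div_sqrt_progression_le {s L c : ℝ} (hs : 0 < s) (hLs : L ≤ s ^ 2)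
    (Y : Finset ℕ) (k : ℕ → ℤ) (hk : Set.InjOn k Y) (v : ℕ → ℝ) (hv : ∀ y ∈ Y, 1 ≤ v y)
    (h0 : ∀ y ∈ Y, 0 ≤ c + k y * s) (hL : ∀ y ∈ Y, c + k y * s ≤ L)
    (hkv : ∀ y ∈ Y, c + k y * s ≤ v y) :
    ∑ y ∈ Y, 1 / √(v y) ≤ 3 := by
  rcases Y.eq_empty_or_nonempty with rfl | ⟨y₀, hy₀⟩
  · simp
  have hL0 : 0 ≤ L := (h0 y₀ hy₀).trans (hL y₀ hy₀)
  set g : ℕ → ℕ := fun y => ⌊(c + k y * s) / s⌋₊ with hg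
  have hfloor : ∀ y, ⌊(c + k y * s) / s⌋ = ⌊c / s⌋ + k y := fun y => by
    rw [← Int.floor_add_intCast]; congr 1; field_simp
  have hginj : Set.InjOn g Y := by
    intro y hy z hz h
    refine hk hy hz ?_
    have h' : ((⌊(c + k y * s) / s⌋₊ : ℕ) : ℤ) = (⌊(c + k z * s) / s⌋₊ : ℕ) := by exact_mod_cast h
    rw [Int.natCast_floor_eq_floor (div_nonneg (h0 y hy) hs.le),
      Int.natCast_floor_eq_floor (div_nonneg (h0 z hz) hs.le), hfloor, hfloor] at h'
    omega
  -- The indicator is needed because `1 / √0` evaluates to `0`.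
  have hterm : ∀ y ∈ Y, 1 / √(v y) ≤ (if g y = 0 then 1 else 0) + 1 / √s * (1 / √(g y : ℝ)) := by
    intro y hy
    split_ifs with h
    · rw [h]
      simp only [Nat.cast_zero, Real.sqrt_zero, div_zero, mul_zero, add_zero]
      rw [div_le_one (Real.sqrt_pos.2 (by linarith [hv y hy]))]
      exact Real.one_le_sqrt.2 (hv y hy)
    · have hpos : (0 : ℝ) < g y := by exact_mod_cast Nat.pos_of_ne_zero h
      have h1 : (g y : ℝ) ≤ (c + k y * s) / s := Nat.floor_le (div_nonneg (h0 y hy) hs.le)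
      rw [le_div_iff₀ hs] at h1
      rw [zero_add, one_div_mul_one_div, ← Real.sqrt_mul hs.le]
      gcongr
      linarith [hkv y hy]
  have himg : Y.image g ⊆ Finset.range (⌊L / s⌋₊ + 1) := by
    intro i hi
    obtain ⟨y, hy, rfl⟩ := Finset.mem_image.1 hi
    rw [Finset.mem_range, Nat.lt_succ_iff]
    exact Nat.floor_le_floor (by gcongr; exact hL y hy)
  have hR : √(⌊L / s⌋₊ : ℝ) ≤ √s := by
    refine Real.sqrt_le_sqrt ((Nat.floor_le (by positivity)).trans ?_)
    rw [div_le_iff₀ hs]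
    linarith
  calc _ ≤ ∑ y ∈ Y, ((if g y = 0 then 1 else 0) + 1 / √s * (1 / √(g y : ℝ))) :=
        Finset.sum_le_sum hterm
    _ = ∑ i ∈ Y.image g, ((if i = 0 then 1 else 0) + 1 / √s * (1 / √(i : ℝ))) :=
      (Finset.sum_image (f := fun i : ℕ => (if i = 0 then 1 else 0) + 1 / √s * (1 / √(i : ℝ)))
        hginj).symm
    _ ≤ ∑ i ∈ Finset.range (⌊L / s⌋₊ + 1), ((if i = 0 then 1 else 0) + 1 / √s * (1 / √(i : ℝ))) :=
      Finset.sum_le_sum_of_subset_of_nonneg himg fun i _ _ => by positivity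
    _ = 1 + 1 / √s * ∑ i ∈ Finset.range (⌊L / s⌋₊ + 1), 1 / √(i : ℝ) := by
      rw [Finset.sum_add_distrib, ← Finset.mul_sum]
      simp
    _ ≤ 1 + 1 / √s * (2 * √s) := by
      gcongr
      exact (sum_one_div_sqrt_le _).trans (by gcongr)
    _ = 3 := by
      have : √s ≠ 0 := (Real.sqrt_pos.2 hs).ne'
      field_simp
      norm_num

/-! ### The teeth of the comb -/

/-- The labels in `0, …, N` of the Dicke states that make up the comb with spacing `s`. -/
noncomputable def combTeeth (N : ℕ) (s : ℝ) : Finset ℕ :=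
  open Classical in (Finset.range (N + 1)).filter fun n =>
    ∃ m ∈ Finset.Icc (-⌊(N : ℝ) / s⌋) ⌊(N : ℝ) / s⌋, ⌊(N : ℝ) / 2 + m * s⌋ = (n : ℤ)

theorem le_of_mem_combTeeth {N : ℕ} {s : ℝ} {n : ℕ} (h : n ∈ combTeeth N s) : n ≤ N := by
  classical
  rw [combTeeth, Finset.mem_filter, Finset.mem_range] at h
  omega

theorem exists_of_mem_combTeeth {N : ℕ} {s : ℝ} {n : ℕ} (h : n ∈ combTeeth N s) :
    ∃ m : ℤ, (n : ℝ) ≤ N / 2 + m * s ∧ (N : ℝ) / 2 + m * s < n + 1 := by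
  classical
  rw [combTeeth, Finset.mem_filter] at h
  obtain ⟨-, m, -, hm⟩ := h
  rw [Int.floor_eq_iff] at hm
  exact ⟨m, by exact_mod_cast hm.1, by exact_mod_cast hm.2⟩

theorem floor_progression_injective {s : ℝ} (hs : 1 ≤ s) (c : ℝ) :
    Function.Injective fun m : ℤ => ⌊c + m * s⌋ := by
  refine StrictMono.injective fun m m' h => ?_
  have h1 : (m : ℝ) + 1 ≤ m' := by exact_mod_cast h
  have h2 : c + m * s + 1 ≤ c + m' * s := by nlinarith
  have h3 := Int.floor_le_floor h2
  rw [Int.floor_add_one] at h3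
  exact Int.lt_of_add_one_le h3

theorem div_le_card_combTeeth {N : ℕ} {s : ℝ} (hs : 1 ≤ s) :
    (N : ℝ) / (2 * s) ≤ (combTeeth N s).card := by
  classical
  have hs0 : 0 < s := by linarith
  -- The comb runs up to `|m| ≤ N / s`, but half that range already stays inside `0, …, N`.
  set J := ⌊(N : ℝ) / (2 * s)⌋ with hJ
  have hJ0 : 0 ≤ J := Int.floor_nonneg.2 (by positivity)
  have hb : ∀ m ∈ Finset.Icc (-J) J, 0 ≤ (N : ℝ) / 2 + m * s ∧ (N : ℝ) / 2 + m * s ≤ N := by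
    intro m hm
    rw [Finset.mem_Icc] at hm
    have h1 : (m : ℝ) ≤ N / (2 * s) := (Int.cast_le.2 hm.2).trans (Int.floor_le _)
    have h2 : -(m : ℝ) ≤ N / (2 * s) := by
      have : ((-m : ℤ) : ℝ) ≤ J := Int.cast_le.2 (by omega)
      push_cast at this
      exact this.trans (Int.floor_le _)
    rw [le_div_iff₀ (by positivity)] at h1 h2
    constructor <;> linarith
  have hcard : (Finset.Icc (-J) J).card ≤ (combTeeth N s).card := by
    refine Finset.card_le_card_of_injOn (fun m => (⌊(N : ℝ) / 2 + m * s⌋).toNat) ?_ ?_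
    · intro m hm
      have hm' := hb m hm
      have h0 : 0 ≤ ⌊(N : ℝ) / 2 + m * s⌋ := Int.floor_nonneg.2 hm'.1
      have h1 : ⌊(N : ℝ) / 2 + m * s⌋ ≤ N := by
        have := Int.floor_le_floor hm'.2
        rwa [Int.floor_natCast] at this
      have h2 : J ≤ ⌊(N : ℝ) / s⌋ := Int.floor_le_floor (by gcongr; linarith)
      have hm2 := Finset.mem_Icc.1 (Finset.mem_coe.1 hm)
      rw [Finset.mem_coe, combTeeth, Finset.mem_filter, Finset.mem_range]
      simp only
      exact ⟨by omega, m, Finset.mem_Icc.2 ⟨by omega, by omega⟩, by omega⟩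
    · intro m hm m' hm' h
      refine floor_progression_injective hs (N / 2) ?_
      have h0 : 0 ≤ ⌊(N : ℝ) / 2 + m * s⌋ := Int.floor_nonneg.2 (hb m hm).1
      have h0' : 0 ≤ ⌊(N : ℝ) / 2 + m' * s⌋ := Int.floor_nonneg.2 (hb m' hm').1
      simp only at h ⊢
      omega
  have h2 : (N : ℝ) / (2 * s) < J + 1 := Int.lt_floor_add_one _
  have h3 : (J : ℝ) + 1 ≤ (Finset.Icc (-J) J).card := by
    rw [Int.card_Icc]
    have : J + 1 ≤ ((J + 1 - -J).toNat : ℤ) := by omega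
    exact_mod_cast this
  have h4 : ((Finset.Icc (-J) J).card : ℝ) ≤ (combTeeth N s).card := by exact_mod_cast hcard
  linarith

/-- Each end of the comb gives a progression with at most one tooth per index, contributing at most
3. -/
theorem sum_combTeeth_le {N : ℕ} {s : ℝ} (hs : 0 < s) (hNs : (N : ℝ) + 1 ≤ s ^ 2) :
    ∑ n ∈ combTeeth N s, (1 / √((n : ℝ) + 1) + 1 / √(((N - n : ℕ) : ℝ) + 1)) ≤ 6 := by
  have hex := fun n (h : n ∈ combTeeth N s) => exists_of_mem_combTeeth h
  choose! k hk1 hk2 using hex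
  have hkinj : Set.InjOn k (combTeeth N s) := by
    intro y hy z hz h
    have hy1 := hk1 y hy
    have hy2 := hk2 y hy
    rw [h] at hy1 hy2
    have h1 : (y : ℝ) < (z + 1 : ℕ) := by push_cast; linarith [hk2 z hz]
    have h2 : (z : ℝ) < (y + 1 : ℕ) := by push_cast; linarith [hk1 z hz]
    have h1' := Nat.cast_lt.1 h1
    have h2' := Nat.cast_lt.1 h2
    omega
  have hle : ∀ n ∈ combTeeth N s, (n : ℝ) ≤ N := fun n hn => by
    exact_mod_cast le_of_mem_combTeeth hn
  rw [Finset.sum_add_distrib]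
  have hA := sum_one_div_sqrt_progression_le (c := N / 2) hs hNs (combTeeth N s) k hkinj
    (fun n => (n : ℝ) + 1) (fun n _ => by simp)
    (fun n hn => (Nat.cast_nonneg n).trans (hk1 n hn))
    (fun n hn => by linarith [hk2 n hn, hle n hn]) (fun n hn => (hk2 n hn).le)
  -- The reflected progression is shifted by one, since rounding a label down can leave `N / 2 - m *
  -- s` slightly negative.
  have hB := sum_one_div_sqrt_progression_le (c := N / 2 + 1) hs hNs (combTeeth N s)
    (fun n => -k n) (fun y hy z hz h => hkinj hy hz (neg_injective h))
    (fun n => ((N - n : ℕ) : ℝ) + 1) (fun n _ => by simp)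
    (fun n hn => by push_cast; linarith [hk2 n hn, hle n hn])
    (fun n hn => by
      push_cast
      have : (0 : ℝ) ≤ n := Nat.cast_nonneg n
      linarith [hk1 n hn])
    (fun n hn => by
      rw [Nat.cast_sub (le_of_mem_combTeeth hn)]
      push_cast
      linarith [hk1 n hn])
  linarith

/-! ### Purity of a matrix concentrated near a diagonal -/

/-- A bound for the purity `∑ |(ψ ψᵀ) a a'|²` of a matrix `ψ` whose entries decay, in the sense that
they are weighted by `f`, away from a diagonal. -/
theorem sum_sq_gram_le {ι κ : Type*} (A : Finset ι) (B : Finset κ) (ψ f : ι → κ → ℝ)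
    (w : ι → ι → ℝ) {K : ℝ} (hK : 0 ≤ K) (hf : ∀ a b, 0 < f a b) (hw : ∀ a a', 0 ≤ w a a')
    (hsymm : ∀ a a', w a a' = w a' a)
    (h1 : ∀ a ∈ A, ∀ a' ∈ A, ∀ b ∈ B, ψ a b ≠ 0 → ψ a' b ≠ 0 → 1 ≤ w a a' * (f a b * f a' b))
    (h2 : ∀ a ∈ A, ∑ a' ∈ A, w a a' ≤ K)
    (h3 : ∀ a ∈ A, ∀ B' ⊆ B, (∀ b ∈ B', ψ a b ≠ 0) → ∑ b ∈ B', 1 / f a b ≤ K) :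
    ∑ a ∈ A, ∑ a' ∈ A, (∑ b ∈ B, ψ a b * ψ a' b) ^ 2 ≤
      K ^ 2 * ∑ a ∈ A, ∑ b ∈ B, (ψ a b ^ 2) ^ 2 * f a b ^ 3 := by
  classical
  set q : ι → ℝ := fun a => ∑ b ∈ B, ψ a b ^ 2 * f a b with hq
  -- Cauchy–Schwarz over `b`: wherever both rows are nonzero, `h1` pays for the weight `w a a'`.
  have hR : ∀ a ∈ A, ∀ a' ∈ A, (∑ b ∈ B, ψ a b * ψ a' b) ^ 2 ≤ w a a' * (q a * q a') := by
    intro a ha a' ha'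
    have hm : w a a' * (q a * q a') =
        (∑ b ∈ B, w a a' * (ψ a b ^ 2 * f a b)) * ∑ b ∈ B, ψ a' b ^ 2 * f a' b := by
      rw [← mul_assoc, ← Finset.mul_sum]
    rw [hm]
    refine Finset.sum_sq_le_sum_mul_sum_of_sq_le_mul (R := ℝ) B (fun b _ => ?_) (fun b _ => ?_)
      fun b hb => ?_
    · have := hf a b
      have := hw a a'
      positivity
    · have := hf a' b
      positivity
    · by_cases h : ψ a b = 0
      · simp [h]
      by_cases h' : ψ a' b = 0
      · simp [h']
      have := h1 a ha a' ha' b hb h h'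
      calc (ψ a b * ψ a' b) ^ 2 = (ψ a b * ψ a' b) ^ 2 * 1 := by ring
        _ ≤ (ψ a b * ψ a' b) ^ 2 * (w a a' * (f a b * f a' b)) := by gcongr
        _ = _ := by ring
  -- Cauchy–Schwarz for the splitting `ψ² f = f^(-1/2) * (ψ² f^(3/2))`; this is the origin of the
  -- cube.
  have hq2 : ∀ a ∈ A, q a ^ 2 ≤ K * ∑ b ∈ B, (ψ a b ^ 2) ^ 2 * f a b ^ 3 := by
    intro a ha
    have hq' : q a = ∑ b ∈ B.filter (fun b => ψ a b ≠ 0), ψ a b ^ 2 * f a b := by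
      rw [hq, Finset.sum_filter_of_ne]
      rintro b - h h0
      simp [h0] at h
    have hCS : q a ^ 2 ≤ (∑ b ∈ B.filter (fun b => ψ a b ≠ 0), 1 / f a b) *
        ∑ b ∈ B.filter (fun b => ψ a b ≠ 0), (ψ a b ^ 2) ^ 2 * f a b ^ 3 := by
      rw [hq']
      refine Finset.sum_sq_le_sum_mul_sum_of_sq_le_mul _ (fun b _ => ?_) (fun b _ => ?_)
        fun b _ => ?_
      · have := hf a b
        positivity
      · have := hf a b
        positivity
      · have := (hf a b).ne'
        refine le_of_eq ?_
        field_simp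
    refine hCS.trans ?_
    gcongr
    · exact Finset.sum_nonneg fun b _ => by have := hf a b; positivity
    · exact h3 a ha _ (Finset.filter_subset _ _) fun b hb => (Finset.mem_filter.1 hb).2
    · intro b _ _
      have := hf a b
      positivity
    · exact Finset.filter_subset _ _
  have hsum : ∑ a ∈ A, ∑ a' ∈ A, w a a' * q a' ^ 2 = ∑ a ∈ A, ∑ a' ∈ A, w a a' * q a ^ 2 := by
    rw [Finset.sum_comm]
    exact Finset.sum_congr rfl fun a _ => Finset.sum_congr rfl fun a' _ => by rw [hsymm]
  -- Schur test: `q a * q a'` is split by AM–GM, and the symmetry of `w` makes the two halves equal.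
  calc _ ≤ ∑ a ∈ A, ∑ a' ∈ A, (w a a' * q a ^ 2 / 2 + w a a' * q a' ^ 2 / 2) := by
        refine Finset.sum_le_sum fun a ha => Finset.sum_le_sum fun a' ha' => ?_
        refine (hR a ha a' ha').trans ?_
        have := mul_nonneg (hw a a') (sq_nonneg (q a - q a'))
        nlinarith
    _ = ∑ a ∈ A, ∑ a' ∈ A, w a a' * q a ^ 2 := by
      simp only [Finset.sum_add_distrib, ← Finset.sum_div]
      rw [hsum]
      ring
    _ = ∑ a ∈ A, (∑ a' ∈ A, w a a') * q a ^ 2 := by simp only [Finset.sum_mul]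
    _ ≤ ∑ a ∈ A, K * (K * ∑ b ∈ B, (ψ a b ^ 2) ^ 2 * f a b ^ 3) := by
      refine Finset.sum_le_sum fun a ha => ?_
      exact mul_le_mul (h2 a ha) (hq2 a ha) (sq_nonneg _) hK
    _ = _ := by rw [← Finset.mul_sum, ← Finset.mul_sum]; ring

/-! ### Sums over configurations -/

/-- Vandermonde's identity, applied on each antidiagonal. -/
theorem sum_choose_mul_choose {k l : ℕ} (G : ℕ → ℝ) :
    ∑ a ∈ Finset.range (k + 1), ∑ b ∈ Finset.range (l + 1),
        (k.choose a * l.choose b : ℝ) * G (a + b) =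
      ∑ n ∈ Finset.range (k + l + 1), ((k + l).choose n : ℝ) * G n := by
  rw [← Finset.sum_product',
    ← Finset.sum_fiberwise_of_maps_to (g := fun p : ℕ × ℕ => p.1 + p.2)
      (t := Finset.range (k + l + 1))]
  · refine Finset.sum_congr rfl fun n _ => ?_
    rw [Nat.add_choose_eq, Nat.cast_sum, Finset.sum_mul]
    refine Finset.sum_subset_zero_on_sdiff ?_ ?_ ?_
    · intro p hp
      rw [Finset.mem_filter] at hp
      exact Finset.HasAntidiagonal.mem_antidiagonal.2 hp.2
    · intro p hp
      simp only [Finset.mem_sdiff, Finset.HasAntidiagonal.mem_antidiagonal, Finset.mem_filter, Finset.mem_product,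
        Finset.mem_range] at hp
      rcases le_or_gt p.1 k with h | h
      · have : l < p.2 := by
          by_contra h'
          exact hp.2 ⟨⟨by omega, by omega⟩, hp.1⟩
        simp [Nat.choose_eq_zero_of_lt this]
      · simp [Nat.choose_eq_zero_of_lt h]
    · intro p hp
      rw [Finset.mem_filter] at hp
      rw [← hp.2]
      push_cast
      ring
  · intro p hp
    simp only [Finset.mem_product, Finset.mem_range] at hp ⊢
    omega

/-- Summing over configurations a function of the number of spins up. -/
theorem sum_card_filter_eq_one {ι : Type*} [Fintype ι] [DecidableEq ι] {M : Type*}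
    [AddCommMonoid M] (F : ℕ → M) :
    ∑ x : ι → Fin 2, F (Finset.univ.filter fun i => x i = 1).card =
      ∑ n ∈ Finset.range (Fintype.card ι + 1), (Fintype.card ι).choose n • F n := by
  rw [← Finset.card_univ, ← Finset.sum_powerset_apply_card, Finset.powerset_univ]
  refine Finset.sum_bij' (fun x _ => Finset.univ.filter fun i => x i = 1)
    (fun S _ i => if i ∈ S then 1 else 0) ?_ ?_ ?_ ?_ ?_
  · simp
  · simp
  · intro x _
    ext i
    rcases Fin.exists_fin_two.1 ⟨x i, rfl⟩ with h | h <;> simp [h]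
  · intro S _
    ext i
    simp
  · simp

/-! ### Purity and entropy -/

section Entropy

variable {ι : Type*} [Fintype ι] [DecidableEq ι]

theorem Matrix.IsHermitian.sum_eigenvalues_sq {ρ : Matrix ι ι ℂ} (hρ : ρ.IsHermitian) :
    ∑ i, hρ.eigenvalues i ^ 2 = ∑ i, ∑ j, ‖ρ i j‖ ^ 2 := by
  have h1 : (ρ * ρ).trace = ∑ i, ((hρ.eigenvalues i : ℂ)) ^ 2 := by
    conv_lhs => rw [hρ.spectral_theorem, ← map_mul, Matrix.diagonal_mul_diagonal,
      Unitary.conjStarAlgAut_apply, Matrix.trace_mul_comm, ← mul_assoc]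
    simp [Matrix.trace_diagonal, sq]
  have h2 : (ρ * ρ).trace = ∑ i, ∑ j, ((‖ρ i j‖ ^ 2 : ℝ) : ℂ) := by
    rw [Matrix.trace]
    refine Finset.sum_congr rfl fun i _ => ?_
    rw [Matrix.diag_apply, Matrix.mul_apply]
    refine Finset.sum_congr rfl fun j _ => ?_
    rw [← hρ.apply j i, Complex.star_def, Complex.mul_conj, Complex.normSq_eq_norm_sq]
  rw [h1] at h2
  exact_mod_cast h2

open scoped ComplexOrder in
/-- The von Neumann entropy is at least the Rényi entropy of order two. -/
theorem neg_logb_le_vonNeumannEntropy {ρ : Matrix ι ι ℂ} (hρ : ρ.PosSemidef)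
    (htr : ρ.trace = 1) {T : ℝ} (hT : 0 < T) (hle : ∑ i, ∑ j, ‖ρ i j‖ ^ 2 ≤ T) :
    -Real.logb 2 T ≤ vonNeumannEntropy ρ hρ.isHermitian := by
  rw [← hρ.isHermitian.sum_eigenvalues_sq] at hle
  have hsum : ∑ i, hρ.isHermitian.eigenvalues i = 1 := by
    have := hρ.isHermitian.trace_eq_sum_eigenvalues
    rw [htr] at this
    exact Complex.ofReal_injective (by push_cast; exact this.symm)
  have hlog2 : 0 < Real.log 2 := Real.log_pos one_lt_two
  -- The tangent bound `log (x / T) ≤ x / T - 1` replaces Jensen; after summation its correction is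
  -- purity over `T` minus one, which is nonpositive.
  have hterm : ∀ i, hρ.isHermitian.eigenvalues i * Real.log (hρ.isHermitian.eigenvalues i) ≤
      hρ.isHermitian.eigenvalues i * Real.log T +
        (hρ.isHermitian.eigenvalues i ^ 2 / T - hρ.isHermitian.eigenvalues i) := by
    intro i
    set x := hρ.isHermitian.eigenvalues i
    rcases (hρ.eigenvalues_nonneg i).eq_or_lt with h | h
    · have : x = 0 := h.symm
      simp [this]
    · have h1 := Real.log_le_sub_one_of_pos (div_pos h hT)
      rw [Real.log_div h.ne' hT.ne'] at h1
      calc x * Real.log x ≤ x * (Real.log T + (x / T - 1)) := by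
            gcongr
            linarith
        _ = _ := by ring
  have hS : ∑ i, hρ.isHermitian.eigenvalues i * Real.log (hρ.isHermitian.eigenvalues i) ≤
      Real.log T := by
    refine (Finset.sum_le_sum fun i _ => hterm i).trans ?_
    rw [Finset.sum_add_distrib, Finset.sum_sub_distrib, ← Finset.sum_mul, ← Finset.sum_div, hsum]
    have : (∑ i, hρ.isHermitian.eigenvalues i ^ 2) / T ≤ 1 := (div_le_one hT).2 hle
    linarith
  rw [vonNeumannEntropy, neg_le_neg_iff]
  simp only [Real.logb, ← mul_div_assoc, ← Finset.sum_div]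
  gcongr

end Entropy

/-! ### Reduced states and excitation numbers -/

open scoped ComplexOrder in
theorem posSemidef_reducedDensity {N : ℕ} (ψ : SpinVector N) (A : Finset (Fin N)) :
    (reducedDensity ψ A).PosSemidef := by
  have h : reducedDensity ψ A = (Matrix.of fun a b => ψ (glue A a b)) *
      (Matrix.of fun a b => ψ (glue A a b)).conjTranspose := by
    ext a a'
    simp [reducedDensity, Matrix.mul_apply]
  rw [h]
  exact Matrix.posSemidef_self_mul_conjTranspose _

theorem trace_reducedDensity {N : ℕ} {ψ : SpinVector N} (hψ : ‖ψ‖ = 1) (A : Finset (Fin N)) :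
    (reducedDensity ψ A).trace = 1 := by
  have h1 : ∑ x, ψ x * star (ψ x) = 1 := by
    have h := EuclideanSpace.norm_sq_eq ψ
    rw [hψ] at h
    have h' : ((∑ x, ‖ψ x‖ ^ 2 : ℝ) : ℂ) = 1 := by rw [← h]; simp
    rw [← h']
    push_cast
    refine Finset.sum_congr rfl fun x _ => ?_
    rw [Complex.star_def, Complex.mul_conj, Complex.normSq_eq_norm_sq]
    push_cast
    rfl
  rw [← h1, ← (Equiv.piEquivPiSubtypeProd (fun i => i ∈ A) fun _ => Fin 2).symm.sum_comp,
    Fintype.sum_prod_type]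
  rfl

theorem excitations_glue {N : ℕ} (A : Finset (Fin N)) (a : {i // i ∈ A} → Fin 2)
    (b : {i // i ∉ A} → Fin 2) :
    excitations (glue A a b) = (Finset.univ.filter fun i => a i = 1).card +
      (Finset.univ.filter fun i => b i = 1).card := by
  simp only [excitations, Finset.card_filter]
  rw [← Fintype.sum_subtype_add_sum_subtype (fun i => i ∈ A)]
  refine congrArg₂ (· + ·) (Finset.sum_congr (by ext; simp) fun i _ => ?_)
    (Finset.sum_congr (by ext; simp) fun i _ => ?_)
  · simp [glue, Equiv.piEquivPiSubtypeProd, i.2]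
  · simp [glue, Equiv.piEquivPiSubtypeProd, i.2]

theorem excitations_comp_perm {N : ℕ} (π : Equiv.Perm (Fin N)) (x : Fin N → Fin 2) :
    excitations (x ∘ π) = excitations x := by
  simp only [excitations, Finset.card_filter, Function.comp_apply]
  exact Equiv.sum_comp π fun i => if x i = 1 then 1 else 0

/-- From `(a' - a)² ≤ 2 * ((a - b)² + (a' - b)²)`, whence the doubled width `2 * (N + 1)` of the row
weight. -/
theorem one_le_weight_of_near {N : ℕ} {a a' b : ℕ} :
    1 ≤ 1 / (1 + ((a' : ℝ) - a) ^ 2 / (2 * (N + 1))) *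
      ((1 + ((a : ℝ) - b) ^ 2 / (N + 1)) * (1 + ((a' : ℝ) - b) ^ 2 / (N + 1))) := by
  rw [one_div, ← div_eq_inv_mul, one_le_div (by positivity)]
  have h1 : ((a' : ℝ) - a) ^ 2 / (2 * (N + 1)) ≤
      ((a : ℝ) - b) ^ 2 / (N + 1) + ((a' : ℝ) - b) ^ 2 / (N + 1) := by
    rw [← add_div, div_le_div_iff₀ (by positivity) (by positivity)]
    have : (0 : ℝ) < N + 1 := by positivity
    nlinarith [mul_nonneg this.le (sq_nonneg (((a : ℝ) - b) + (a' - b)))]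
  have h2 : 0 ≤ ((a : ℝ) - b) ^ 2 / (N + 1) * (((a' : ℝ) - b) ^ 2 / (N + 1)) := by positivity
  nlinarith

/-! ### Purity of half of the comb -/

/-- The amplitude of the comb state on each basis configuration with `n` spins up. -/
noncomputable def combAmplitude (N : ℕ) (s : ℝ) (n : ℕ) : ℝ :=
  open Classical in if n ∈ combTeeth N s then (√(N.choose n))⁻¹ else 0

theorem combAmplitude_ne_zero {N : ℕ} {s : ℝ} {n : ℕ} (h : combAmplitude N s n ≠ 0) :
    n ∈ combTeeth N s := by
  classical
  rw [combAmplitude] at h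
  exact (ite_ne_right_iff.1 h).1

theorem combAmplitude_sq_of_mem {N : ℕ} {s : ℝ} {n : ℕ} (h : n ∈ combTeeth N s) :
    combAmplitude N s n ^ 2 = (N.choose n : ℝ)⁻¹ := by
  rw [combAmplitude, if_pos h, inv_pow, Real.sq_sqrt (by positivity)]

/-- A bound for the purity of half of the unnormalized comb vector. -/
theorem sum_sq_gram_combAmplitude_le {N : ℕ} {s : ℝ} (hs : 4 ≤ s) (hNs : (N : ℝ) + 1 ≤ s ^ 2) :
    ∑ a ∈ Finset.range (N / 2 + 1), ∑ a' ∈ Finset.range (N / 2 + 1),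
        ((N / 2).choose a * (N / 2).choose a' : ℝ) *
          (∑ b ∈ Finset.range (N - N / 2 + 1), ((N - N / 2).choose b : ℝ) *
            (combAmplitude N s (a + b) * combAmplitude N s (a' + b))) ^ 2 ≤
      24 * 12 ^ 3 * lorentzianBound ^ 2 := by
  classical
  set k := N / 2 with hk
  set l := N - N / 2 with hl
  have hkl : k + l = N := by omega
  set φ := combAmplitude N s with hφ
  -- The square roots absorb the multiplicities of the configurations: these are the amplitudes in
  -- the Dicke bases of the halves.
  set ψ : ℕ → ℕ → ℝ := fun a b => √(k.choose a) * √(l.choose b) * φ (a + b) with hψ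
  set f : ℕ → ℕ → ℝ := fun a b => 1 + ((a : ℝ) - b) ^ 2 / (N + 1) with hf
  set w : ℕ → ℕ → ℝ := fun a a' =>
    if ∃ b, a + b ∈ combTeeth N s ∧ a' + b ∈ combTeeth N s then
      1 / (1 + ((a' : ℝ) - a) ^ 2 / (2 * (N + 1))) else 0 with hw
  have hψφ : ∀ a b, ψ a b ≠ 0 → a + b ∈ combTeeth N s := fun a b h =>
    combAmplitude_ne_zero (right_ne_zero_of_mul h)
  have hgram := sum_sq_gram_le (Finset.range (k + 1)) (Finset.range (l + 1)) ψ f w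
    lorentzianBound_pos.le (fun a b => by simp only [hf]; positivity)
    (fun a a' => by simp only [hw]; positivity)
    (fun a a' => by
      simp only [hw, and_comm (a := a + _ ∈ _)]
      rw [show ((a' : ℝ) - a) ^ 2 = (a - a') ^ 2 by ring])
    (fun a _ a' _ b _ h h' => by
      simp only [hw, hf]
      rw [if_pos ⟨b, hψφ a b h, hψφ a' b h'⟩]
      exact one_le_weight_of_near)
    (fun a _ => by
      simp only [hw]
      rw [← Finset.sum_filter]
      -- Rows `a` and `a'` sharing a column `b` differ by a difference of two teeth, hence by a
      -- multiple of `s` up to less than one.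
      refine sum_lorentzian_le hs (by positivity) (by linarith) a a _ fun a' ha' => ?_
      obtain ⟨-, b, hb, hb'⟩ := Finset.mem_filter.1 ha'
      obtain ⟨m, hm1, hm2⟩ := exists_of_mem_combTeeth hb
      obtain ⟨m', hm1', hm2'⟩ := exists_of_mem_combTeeth hb'
      refine ⟨m' - m, ?_⟩
      push_cast at hm1 hm2 hm1' hm2' ⊢
      rw [abs_lt]
      constructor <;> linarith)
    (fun a _ B' _ hB' => by
      have := sum_lorentzian_le (L := N + 1) hs (by positivity) (by nlinarith) (N / 2 - a) a B'
        fun b hb => by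
          obtain ⟨m, hm1, hm2⟩ := exists_of_mem_combTeeth (hψφ a b (hB' b hb))
          refine ⟨m, ?_⟩
          push_cast at hm1 hm2
          rw [abs_lt]
          constructor <;> linarith
      refine le_of_eq_of_le (Finset.sum_congr rfl fun b _ => ?_) this
      simp only [hf]
      rw [show ((a : ℝ) - b) ^ 2 = (b - a) ^ 2 by ring])
  have hlhs : ∀ a a', ((k.choose a * k.choose a' : ℝ) *
      (∑ b ∈ Finset.range (l + 1), (l.choose b : ℝ) * (φ (a + b) * φ (a' + b))) ^ 2) =
      (∑ b ∈ Finset.range (l + 1), ψ a b * ψ a' b) ^ 2 := by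
    intro a a'
    have h : ∑ b ∈ Finset.range (l + 1), ψ a b * ψ a' b = √(k.choose a) * √(k.choose a') *
        ∑ b ∈ Finset.range (l + 1), (l.choose b : ℝ) * (φ (a + b) * φ (a' + b)) := by
      rw [Finset.mul_sum]
      refine Finset.sum_congr rfl fun b _ => ?_
      have := Real.mul_self_sqrt (Nat.cast_nonneg (α := ℝ) (l.choose b))
      simp only [hψ]
      calc _ = √(k.choose a) * √(k.choose a') * ((√(l.choose b) * √(l.choose b)) *
          (φ (a + b) * φ (a' + b))) := by ring
        _ = _ := by rw [this]
    rw [h, mul_pow, mul_pow, Real.sq_sqrt (by positivity), Real.sq_sqrt (by positivity)]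
  simp only [hlhs]
  refine hgram.trans ?_
  set h : ℕ → ℝ := fun n => 1 / √((n : ℝ) + 1) + 1 / √(((N - n : ℕ) : ℝ) + 1) with hh
  set G : ℕ → ℝ := fun n => if n ∈ combTeeth N s then h n / N.choose n else 0 with hG
  have hterm : ∀ a ∈ Finset.range (k + 1), ∀ b ∈ Finset.range (l + 1),
      (ψ a b ^ 2) ^ 2 * f a b ^ 3 ≤
        4 * 12 ^ 3 * ((k.choose a * l.choose b : ℝ) * G (a + b)) := by
    intro a ha b hb
    rw [Finset.mem_range, Nat.lt_succ_iff] at ha hb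
    by_cases hab : a + b ∈ combTeeth N s
    · have hψ2 : ψ a b ^ 2 = k.choose a * l.choose b / N.choose (a + b) := by
        simp only [hψ]
        rw [mul_pow, mul_pow, Real.sq_sqrt (by positivity), Real.sq_sqrt (by positivity), hφ,
          combAmplitude_sq_of_mem hab, div_eq_mul_inv]
      have hp := hypergeometric_mul_pow_le ha hb
      rw [← hk, ← hl, ← hψ2] at hp
      simp only [hG, if_pos hab]
      calc (ψ a b ^ 2) ^ 2 * f a b ^ 3 = ψ a b ^ 2 * (ψ a b ^ 2 * f a b ^ 3) := by ring
        _ ≤ ψ a b ^ 2 * (4 * 12 ^ 3 * h (a + b)) := by gcongr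
        _ = _ := by rw [hψ2]; ring
    · have : ψ a b = 0 := by
        by_contra h0
        exact hab (hψφ a b h0)
      simp [this, hG, hab]
  have hGsum : ∑ a ∈ Finset.range (k + 1), ∑ b ∈ Finset.range (l + 1),
      (k.choose a * l.choose b : ℝ) * G (a + b) ≤ 6 := by
    rw [sum_choose_mul_choose, hkl]
    refine le_of_eq_of_le ?_ (sum_combTeeth_le (N := N) (by linarith) hNs)
    have hsub : combTeeth N s ⊆ Finset.range (N + 1) := fun n hn =>
      Finset.mem_range.2 (Nat.lt_succ_of_le (le_of_mem_combTeeth hn))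
    rw [← Finset.sum_subset hsub fun n _ hn => by simp [hG, hn]]
    refine Finset.sum_congr rfl fun n hn => ?_
    have : (N.choose n : ℝ) ≠ 0 := by
      exact_mod_cast (Nat.choose_pos (le_of_mem_combTeeth hn)).ne'
    simp only [hG, if_pos hn]
    rw [mul_div_cancel₀ _ this]
  calc _ ≤ lorentzianBound ^ 2 * ∑ a ∈ Finset.range (k + 1), ∑ b ∈ Finset.range (l + 1),
        4 * 12 ^ 3 * ((k.choose a * l.choose b : ℝ) * G (a + b)) := by
        refine mul_le_mul_of_nonneg_left ?_ (sq_nonneg _)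
        exact Finset.sum_le_sum fun a ha => Finset.sum_le_sum fun b hb => hterm a ha b hb
    _ = lorentzianBound ^ 2 * (4 * 12 ^ 3 * ∑ a ∈ Finset.range (k + 1),
        ∑ b ∈ Finset.range (l + 1), (k.choose a * l.choose b : ℝ) * G (a + b)) := by
      simp only [Finset.mul_sum]
    _ ≤ lorentzianBound ^ 2 * (4 * 12 ^ 3 * 6) := by gcongr
    _ = _ := by ring

/-! ### The normalized comb state -/

theorem combVector_apply {N : ℕ} {s : ℝ} (hs : 1 ≤ s) (x : Fin N → Fin 2) :
    combVector N s x = (combAmplitude N s (excitations x) : ℂ) := by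
  classical
  have hx : excitations x ≤ N := by
    simpa [excitations] using Finset.card_filter_le Finset.univ fun i => x i = 1
  have hinj := floor_progression_injective hs ((N : ℝ) / 2)
  rw [combVector, WithLp.ofLp_sum, Finset.sum_apply, combAmplitude]
  simp only [dickeState]
  split_ifs with h
  · rw [combTeeth, Finset.mem_filter] at h
    obtain ⟨-, m, hm, hmx⟩ := h
    rw [Finset.sum_eq_single_of_mem m hm, if_pos hmx.symm]
    intro m' _ hne
    rw [if_neg]
    intro h'
    exact hne (hinj (h'.symm.trans hmx.symm))
  · rw [Complex.ofReal_zero]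
    refine Finset.sum_eq_zero fun m hm => if_neg fun h' => h ?_
    rw [combTeeth, Finset.mem_filter, Finset.mem_range]
    exact ⟨by omega, m, hm, h'.symm⟩

theorem norm_sq_combVector {N : ℕ} {s : ℝ} (hs : 1 ≤ s) :
    ‖combVector N s‖ ^ 2 = (combTeeth N s).card := by
  rw [EuclideanSpace.norm_sq_eq]
  simp only [combVector_apply hs, Complex.norm_real, Real.norm_eq_abs, sq_abs]
  have h := sum_card_filter_eq_one (ι := Fin N) fun n => combAmplitude N s n ^ 2
  simp only [Fintype.card_fin] at h
  refine h.trans ?_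
  have hsub : combTeeth N s ⊆ Finset.range (N + 1) := fun n hn =>
    Finset.mem_range.2 (Nat.lt_succ_of_le (le_of_mem_combTeeth hn))
  rw [← Finset.sum_subset hsub fun n _ hn => ?_]
  · rw [Finset.card_eq_sum_ones, Nat.cast_sum]
    refine Finset.sum_congr rfl fun n hn => ?_
    have : (N.choose n : ℝ) ≠ 0 := by
      exact_mod_cast (Nat.choose_pos (le_of_mem_combTeeth hn)).ne'
    rw [combAmplitude_sq_of_mem hn, nsmul_eq_mul, mul_inv_cancel₀ this, Nat.cast_one]
  · have : combAmplitude N s n = 0 := by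
      by_contra h0
      exact hn (combAmplitude_ne_zero h0)
    simp [this]

theorem combState_mem_symmetricSubspace {N : ℕ} {s : ℝ} (hs : 1 ≤ s) :
    combState N s ∈ symmetricSubspace N := by
  refine Submodule.smul_mem _ _ fun π x => ?_
  rw [combVector_apply hs, combVector_apply hs, excitations_comp_perm]

theorem norm_combState {N : ℕ} {s : ℝ} (hs : 1 ≤ s) (hN : 0 < N) : ‖combState N s‖ = 1 := by
  have h0 : combVector N s ≠ 0 := by
    intro h
    have h1 := norm_sq_combVector (N := N) hs
    have h2 := div_le_card_combTeeth (N := N) hs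
    rw [← h1, h, norm_zero] at h2
    have : (0 : ℝ) < N / (2 * s) := by positivity
    linarith
  rw [combState, norm_smul, Complex.norm_real, norm_inv, norm_norm,
    inv_mul_cancel₀ (norm_ne_zero_iff.2 h0)]

/-- Amplitudes depend only on excitation numbers, so tracing out `B` groups its configurations by
their number of spins up. -/
theorem reducedDensity_combState {N : ℕ} {s : ℝ} (hs : 1 ≤ s) (A : Finset (Fin N))
    (a a' : {i // i ∈ A} → Fin 2) :
    reducedDensity (combState N s) A a a' =
      (((combTeeth N s).card : ℝ)⁻¹ * ∑ b ∈ Finset.range (N - A.card + 1),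
        ((N - A.card).choose b : ℝ) *
          (combAmplitude N s ((Finset.univ.filter fun i => a i = 1).card + b) *
            combAmplitude N s ((Finset.univ.filter fun i => a' i = 1).card + b)) : ℝ) := by
  have hc : Fintype.card {i // i ∉ A} = N - A.card := by simp
  have h := sum_card_filter_eq_one (ι := {i // i ∉ A}) fun n =>
    combAmplitude N s ((Finset.univ.filter fun i => a i = 1).card + n) *
      combAmplitude N s ((Finset.univ.filter fun i => a' i = 1).card + n)
  simp only [hc, nsmul_eq_mul] at h
  rw [← h, Finset.mul_sum, Complex.ofReal_sum, reducedDensity, Matrix.of_apply]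
  refine Fintype.sum_congr _ _ fun b => ?_
  rw [← norm_sq_combVector hs, combState]
  simp only [PiLp.smul_apply, combVector_apply hs, excitations_glue, smul_eq_mul, star_mul',
    Complex.star_def, Complex.conj_ofReal]
  push_cast
  ring

theorem sum_sq_reducedDensity_combState_le {N : ℕ} {s : ℝ} (hs : 4 ≤ s)
    (hNs : (N : ℝ) + 1 ≤ s ^ 2) {A : Finset (Fin N)} (hA : A.card = N / 2) :
    ∑ a, ∑ a', ‖reducedDensity (combState N s) A a a'‖ ^ 2 ≤
      24 * 12 ^ 3 * lorentzianBound ^ 2 / ((combTeeth N s).card : ℝ) ^ 2 := by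
  simp only [reducedDensity_combState (show 1 ≤ s by linarith), hA, Complex.norm_real,
    Real.norm_eq_abs, sq_abs]
  set F : ℕ → ℕ → ℝ := fun α α' => (((combTeeth N s).card : ℝ)⁻¹ *
    ∑ b ∈ Finset.range (N - N / 2 + 1), ((N - N / 2).choose b : ℝ) *
      (combAmplitude N s (α + b) * combAmplitude N s (α' + b))) ^ 2 with hF
  have hc : Fintype.card {i // i ∈ A} = N / 2 := by simp [hA]
  have h1 : ∀ α, ∑ a' : {i // i ∈ A} → Fin 2, F α (Finset.univ.filter fun i => a' i = 1).card =
      ∑ n ∈ Finset.range (N / 2 + 1), (N / 2).choose n • F α n := fun α => by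
    rw [sum_card_filter_eq_one (F α), hc]
  have h2 := sum_card_filter_eq_one (ι := {i // i ∈ A}) fun α =>
    ∑ n ∈ Finset.range (N / 2 + 1), (N / 2).choose n • F α n
  rw [hc] at h2
  refine le_of_eq_of_le ((Fintype.sum_congr _ _ fun a => h1 _).trans h2) ?_
  have h3 := sum_sq_gram_combAmplitude_le hs hNs
  calc _ = (((combTeeth N s).card : ℝ)⁻¹) ^ 2 * _ := ?_
    _ ≤ (((combTeeth N s).card : ℝ)⁻¹) ^ 2 * (24 * 12 ^ 3 * lorentzianBound ^ 2) :=
      mul_le_mul_of_nonneg_left h3 (by positivity)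
    _ = _ := by rw [inv_pow, ← div_eq_inv_mul]
  simp only [Finset.mul_sum, Finset.smul_sum, nsmul_eq_mul, hF]
  refine Finset.sum_congr rfl fun a _ => Finset.sum_congr rfl fun a' _ => ?_
  rw [← Finset.mul_sum]
  ring

/-! ### Conclusion -/

/-- The lower bound on `s ^ 2` keeps the teeth separated on the scale of the decay; the upper bound
provides enough teeth. -/
theorem spacing_bounds {N : ℕ} (hN : 64 < N) {s : ℝ} (hs : |s - √(2 * (N : ℝ))| ≤ 1) :
    4 ≤ s ∧ (N : ℝ) + 1 ≤ s ^ 2 ∧ s ^ 2 ≤ 4 * N := by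
  have hN' : (64 : ℝ) < N := by exact_mod_cast hN
  set r := √(2 * (N : ℝ)) with hr
  have hr2 : r ^ 2 = 2 * N := Real.sq_sqrt (by positivity)
  have hr8 : 8 ≤ r := Real.le_sqrt_of_sq_le (by linarith)
  obtain ⟨h1, h2⟩ := abs_le.1 hs
  refine ⟨by linarith, ?_, ?_⟩ <;> nlinarith

theorem mainTheorem1 :
    ∃ δ : ℝ, 0 < δ ∧ ∃ N₀ : ℕ, 0 < N₀ ∧ ∀ N : ℕ, N₀ < N →
      ∀ s : ℝ, |s - √(2 * (N : ℝ))| ≤ 1 →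
        combState N s ∈ symmetricSubspace N ∧ ‖combState N s‖ = 1 ∧
        ∀ A : Finset (Fin N), A.card = N / 2 →
          Real.logb 2 (((N / 2 : ℕ) : ℝ) + 1) - entanglementEntropy (combState N s) A < δ := by
  -- The factor 16 comes from `(N / (2 * s)) ^ 2 ≥ N / 16`, valid since `s ^ 2 ≤ 4 * N`.
  set D : ℝ := 16 * (24 * 12 ^ 3 * lorentzianBound ^ 2) with hD
  have hD0 : 0 < D := by have := lorentzianBound_pos; positivity
  refine ⟨|Real.logb 2 D| + 1, by positivity, 64, by norm_num, fun N hN s hs => ?_⟩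
  obtain ⟨hs4, hNs, hsN⟩ := spacing_bounds hN hs
  have hs1 : 1 ≤ s := by linarith
  have hnorm := norm_combState hs1 (show 0 < N by omega)
  refine ⟨combState_mem_symmetricSubspace hs1, hnorm, fun A hA => ?_⟩
  have hN0 : (0 : ℝ) < N := by exact_mod_cast (show 0 < N by omega)
  have hcard : (N : ℝ) / 16 ≤ ((combTeeth N s).card : ℝ) ^ 2 := by
    calc (N : ℝ) / 16 ≤ (N / (2 * s)) ^ 2 := by
          rw [div_pow, div_le_div_iff₀ (by positivity) (by positivity)]
          nlinarith
      _ ≤ _ := by gcongr; exact div_le_card_combTeeth hs1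
  have hk : ((N / 2 : ℕ) : ℝ) + 1 ≤ N := by exact_mod_cast (show N / 2 + 1 ≤ N by omega)
  have hpurity : ∑ a, ∑ a', ‖reducedDensity (combState N s) A a a'‖ ^ 2 ≤
      D / (((N / 2 : ℕ) : ℝ) + 1) := by
    refine (sum_sq_reducedDensity_combState_le hs4 hNs hA).trans ?_
    calc _ ≤ 24 * 12 ^ 3 * lorentzianBound ^ 2 / ((N : ℝ) / 16) := by gcongr
      _ = D / N := by rw [hD]; field_simp
      _ ≤ _ := by gcongr
  have hent := neg_logb_le_vonNeumannEntropy (posSemidef_reducedDensity (combState N s) A)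
    (trace_reducedDensity hnorm A) (by positivity) hpurity
  rw [Real.logb_div hD0.ne' (by positivity)] at hent
  have := le_abs_self (Real.logb 2 D)
  rw [entanglementEntropy]
  linarith
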